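/- Let $M$ be a von Neumann algebra acting on a separable complex Hilbert space $H$, and let $\tau$ be a faithful normal trace on $M$, that is, an ultraweakly continuous linear functional with $\tau(AB)=\tau(BA)$ for all $A,B\in M$, and with $\tau(A)\ge 0$ for every positive $A\in M$, where $\tau(A)=0$ only if $A=0$ (so $M$ is finite). Let $M_*$ be the predual of $M$ (the ultraweakly continuous linear functionals on $M$), let $B(M)$ be the algebra of bounded linear operators on $M$, and let $B_w(M)$ be the set of those that are ultraweakly (weak*) continuous. For $\phi\in B_w(M)$ let $\phi_*:M_*\to M_*$, $\phi_*(l)=l\circ\phi$, be its preadjoint. Let $\Psi_\tau:M\to M_*$ be the injective linear map $X\mapsto l_X$, $l_X(Y)=\tau(XY)$. Put $$\widehat B_\tau(M)=\{\phi\in B_w(M):\ \phi_*(\operatorname{ran}\Psi_\tau)\subset\operatorname{ran}\Psi_\tau\},\qquad \widehat\phi_\tau=\Psi_\tau^{-1}\phi_*\Psi_\tau: M\to M\quad(\phi\in\widehat B_\tau(M)).$$ An operator $\phi\in B(M)$ is $m$-positive if the entrywise map $[A_{i,j}]\mapsto[\phi(A_{i,j})]$ on $m\times m$ matrices over $M$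 (acting on the orthogonal sum of $m$ copies of $H$) takes positive operators to positive operators; it is a projection if $\phi\circ\phi=\phi$. Let $m\ge 2$ and let $\mathcal F\subset\widehat B_\tau(M)$ be a set of pairwise commuting $m$-positive projections. Let $$\mathcal E(\mathcal F)=\{\phi_1\circ\dots\circ\phi_n:\ n\ge 1,\ \phi_1,\dots,\phi_n\in\mathcal F\}$$ be the semigroup generated by $\mathcal F$, directed by: $G\le G'$ if and only if $G'=G''\circ G$ for some $G''\in\mathcal E(\mathcal F)$; it is regarded as a net indexed by itself. Assume that $\mathcal E(\mathcal F)$ and $\widehat{\mathcal E(\mathcal F)}=\{\widehat G_\tau: G\in\mathcal E(\mathcal F)\}$ are bounded in $B(M)$, that is, $\sup_G\|G\|<\infty$ and $\sup_G\|\widehat G_\tau\|<\infty$, where $G$ runs over $\mathcal E(\mathcal F)$. Then the net $\mathcal E(\mathcal F)$ converges weakly to an $m$-positive projection $E\in\widehat B_\tau(M)$: there is an $m$-positive projection $E\in\widehat B_\tau(M)$ such that $l(G(X))\to l(E(X))$ along $G\in\mathcal E(\mathcal F)$ for every $l\in M_*$ and every $X\in M$. -/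

import Mathlib

open scoped Topology ComplexOrder InnerProductSpace

noncomputable section

universe u

namespace FiniteVN

variable {H : Type u} [NormedAddCommGroup H] [InnerProductSpace ℂ H] [CompleteSpace H]

/-- The elements of a von Neumann algebra `M` on `H`, as a normed algebra over `ℂ`. -/
abbrev Elem (M : VonNeumannAlgebra H) : Type u := ↥M.toStarSubalgebra

/-- The ultraweak (that is, weak*) topology of `M`: the coarsest topology that makes all the
functionals `A ↦ ∑ₙ ⟨yₙ, A xₙ⟩` continuous, for sequences `x`, `y` in `H` with
`∑ ‖xₙ‖² < ∞` and `∑ ‖yₙ‖² < ∞`. These functionals are exactly the functionals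
`A ↦ Tr (T A)` with `T` a trace class operator on `H`. -/
@[reducible] def ultraweak (M : VonNeumannAlgebra H) : TopologicalSpace (Elem M) :=
  ⨅ (x : ℕ → H) (y : ℕ → H) (_ : Summable fun n => ‖x n‖ ^ 2) (_ : Summable fun n => ‖y n‖ ^ 2),
    TopologicalSpace.induced (fun A : Elem M => ∑' n, ⟪y n, (A : H →L[ℂ] H) (x n)⟫_ℂ) inferInstance

/-- Left multiplication by an element of `M` is ultraweakly continuous. -/
theorem continuous_mul_left_ultraweak (M : VonNeumannAlgebra H) (X : Elem M) :
    Continuous[ultraweak M, ultraweak M] (fun Y : Elem M => X * Y) := by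
  unfold ultraweak
  simp only [continuous_iInf_rng, continuous_induced_rng]
  intro x y hx hy
  have hy' : Summable fun n => ‖(star (X : H →L[ℂ] H)) (y n)‖ ^ 2 := by
    refine Summable.of_nonneg_of_le (fun n => by positivity) (fun n => ?_)
      (hy.mul_left (‖star (X : H →L[ℂ] H)‖ ^ 2))
    rw [← mul_pow]
    exact pow_le_pow_left₀ (norm_nonneg _) (ContinuousLinearMap.le_opNorm _ _) 2
  have key : ((fun A : Elem M => ∑' n, ⟪y n, (A : H →L[ℂ] H) (x n)⟫_ℂ) ∘ fun Y => X * Y)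
      = fun A : Elem M => ∑' n, ⟪(star (X : H →L[ℂ] H)) (y n), (A : H →L[ℂ] H) (x n)⟫_ℂ := by
    funext A
    simp [ContinuousLinearMap.star_eq_adjoint, ContinuousLinearMap.adjoint_inner_left]
  rw [key]
  refine continuous_iInf_dom (i := x) (continuous_iInf_dom
    (i := fun n => (star (X : H →L[ℂ] H)) (y n)) (continuous_iInf_dom (i := hx)
      (continuous_iInf_dom (i := hy') continuous_induced_dom)))

/-- The predual `M_*`: the space of all ultraweakly continuous linear functionals on `M`. -/
def predual (M : VonNeumannAlgebra H) : Submodule ℂ (Elem M →ₗ[ℂ] ℂ) where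
  carrier := {l | Continuous[ultraweak M, inferInstance] l}
  zero_mem' := by
    exact @continuous_const _ _ (ultraweak M) _ (0 : ℂ)
  add_mem' := by
    intro f g hf hg
    exact @Continuous.add _ _ _ _ _ (ultraweak M) _ _ hf hg
  smul_mem' := by
    intro c f hf
    exact @Continuous.const_smul _ _ _ _ _ _ (ultraweak M) _ hf c

/-- A faithful normal trace on `M`: an ultraweakly continuous linear functional `τ` with
`τ (A B) = τ (B A)`, nonnegative on positive operators, and vanishing on no positive operator
other than `0`. -/
structure FaithfulNormalTrace (M : VonNeumannAlgebra H) where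
  toFun : Elem M →ₗ[ℂ] ℂ
  normal : toFun ∈ predual M
  trace_comm : ∀ A B : Elem M, toFun (A * B) = toFun (B * A)
  nonneg : ∀ A : Elem M, (A : H →L[ℂ] H).IsPositive → 0 ≤ toFun A
  faithful : ∀ A : Elem M, (A : H →L[ℂ] H).IsPositive → toFun A = 0 → A = 0

variable {M : VonNeumannAlgebra H}

/-- The map `Ψ_τ : M → M_*`, `X ↦ l_X`, where `l_X (Y) = τ (X Y)`. -/
def Psi (τ : FaithfulNormalTrace M) : Elem M →ₗ[ℂ] predual M where
  toFun X := ⟨τ.toFun ∘ₗ LinearMap.mulLeft ℂ X,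
    @Continuous.comp _ _ _ (ultraweak M) (ultraweak M) _ (fun Y => X * Y) τ.toFun τ.normal
      (continuous_mul_left_ultraweak M X)⟩
  map_add' X Y := by ext Z; simp [add_mul]
  map_smul' c X := by ext Z; simp

theorem Psi_apply (τ : FaithfulNormalTrace M) (X Y : Elem M) :
    (Psi τ X : Elem M →ₗ[ℂ] ℂ) Y = τ.toFun (X * Y) := rfl

theorem Psi_injective (τ : FaithfulNormalTrace M) : Function.Injective (Psi τ) := by
  rw [injective_iff_map_eq_zero]
  intro X hX
  have h0 : τ.toFun (X * star X) = 0 := by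
    rw [← Psi_apply, hX]; rfl
  have hpos : ((X * star X : Elem M) : H →L[ℂ] H).IsPositive := by
    have := ContinuousLinearMap.isPositive_self_comp_adjoint (X : H →L[ℂ] H)
    simpa [ContinuousLinearMap.star_eq_adjoint] using! this
  have h1 := τ.faithful _ hpos h0
  have h2 : (X : H →L[ℂ] H) * star (X : H →L[ℂ] H) = 0 := congrArg Subtype.val h1
  exact Subtype.ext (CStarRing.mul_star_self_eq_zero_iff _ |>.mp h2)

/-- `B(M)`: the bounded linear operators on `M`. -/
abbrev BM (M : VonNeumannAlgebra H) : Type u := Elem M →L[ℂ] Elem M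

/-- `B_w(M)`: the bounded linear operators on `M` that are ultraweakly (weak*) continuous. -/
def Bw (M : VonNeumannAlgebra H) : Set (BM M) :=
  {φ | Continuous[ultraweak M, ultraweak M] φ}

theorem comp_mem_Bw {φ ψ : BM M} (hφ : φ ∈ Bw M) (hψ : ψ ∈ Bw M) : φ ∘L ψ ∈ Bw M :=
  @Continuous.comp _ _ _ (ultraweak M) (ultraweak M) (ultraweak M) ψ φ hφ hψ

/-- The preadjoint `φ_* : M_* → M_*` of `φ ∈ B_w(M)`: `[φ_* l, X] = [l, φ X]`. -/
def preadjoint (φ : BM M) (hφ : φ ∈ Bw M) : predual M →ₗ[ℂ] predual M where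
  toFun l := ⟨(l : Elem M →ₗ[ℂ] ℂ) ∘ₗ φ.toLinearMap,
    @Continuous.comp _ _ _ (ultraweak M) (ultraweak M) _ φ (l : Elem M →ₗ[ℂ] ℂ) l.2 hφ⟩
  map_add' _ _ := rfl
  map_smul' _ _ := rfl

/-- `B̂_τ(M)`: the operators `φ ∈ B_w(M)` that are `τ`-`M`-stable, that is, `φ_*` maps the range
of `Ψ_τ` into itself. -/
def Bhat (τ : FaithfulNormalTrace M) : Set (BM M) :=
  {φ | ∃ hφ : φ ∈ Bw M, ∀ l ∈ LinearMap.range (Psi τ),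
    preadjoint φ hφ l ∈ LinearMap.range (Psi τ)}

theorem comp_mem_Bhat {τ : FaithfulNormalTrace M} {φ ψ : BM M} (hφ : φ ∈ Bhat τ)
    (hψ : ψ ∈ Bhat τ) : φ ∘L ψ ∈ Bhat τ := by
  obtain ⟨hφ, h1⟩ := hφ
  obtain ⟨hψ, h2⟩ := hψ
  exact ⟨comp_mem_Bw hφ hψ, fun l hl => h2 _ (h1 l hl)⟩

/-- The `τ`-dual `φ̂_τ = Ψ_τ⁻¹ φ_* Ψ_τ : M → M` of `φ ∈ B̂_τ(M)`. -/
def tauDual (τ : FaithfulNormalTrace M) (φ : BM M) (hφ : φ ∈ Bhat τ) : Elem M →ₗ[ℂ] Elem M :=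
  (LinearEquiv.ofInjective (Psi τ) (Psi_injective τ)).symm.toLinearMap ∘ₗ
    LinearMap.codRestrict (LinearMap.range (Psi τ)) (preadjoint φ hφ.1 ∘ₗ Psi τ)
      (fun X => hφ.2 _ (LinearMap.mem_range_self _ X))

/-- The operator on the orthogonal sum of `n` copies of `H` given by an `n × n` matrix of
operators on `H`. -/
def matrixOp {n : ℕ} (A : Matrix (Fin n) (Fin n) (H →L[ℂ] H)) :
    PiLp 2 (fun _ : Fin n => H) →L[ℂ] PiLp 2 (fun _ : Fin n => H) :=
  (PiLp.continuousLinearEquiv 2 ℂ (fun _ : Fin n => H)).symm.toContinuousLinearMap ∘L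
    ContinuousLinearMap.pi (fun i => ∑ j, A i j ∘L ContinuousLinearMap.proj j) ∘L
      (PiLp.continuousLinearEquiv 2 ℂ (fun _ : Fin n => H)).toContinuousLinearMap

/-- `φ` is `n`-positive: the entrywise map `φ_n : M_n(M) → M_n(M)` takes positive operators to
positive operators. -/
def IsNPositive (n : ℕ) (φ : BM M) : Prop :=
  ∀ A : Matrix (Fin n) (Fin n) (Elem M),
    (matrixOp (A.map fun a => (a : H →L[ℂ] H))).IsPositive →
      (matrixOp ((A.map φ).map fun a => (a : H →L[ℂ] H))).IsPositive

/-- The semigroup `E(F)` of all products `φ₁ ∘ ⋯ ∘ φₙ`, `n ≥ 1`, of elements of `F`. -/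
inductive semigroupOf (F : Set (BM M)) : Set (BM M)
  | of {φ : BM M} (hφ : φ ∈ F) : semigroupOf F φ
  | comp {φ G : BM M} (hφ : φ ∈ F) (hG : semigroupOf F G) : semigroupOf F (φ ∘L G)

theorem semigroupOf_subset_Bhat {τ : FaithfulNormalTrace M} {F : Set (BM M)} (hF : F ⊆ Bhat τ) :
    semigroupOf F ⊆ Bhat τ := by
  intro G hG
  induction hG with
  | of hφ => exact hF hφ
  | comp hφ _ ih => exact comp_mem_Bhat (hF hφ) ih

/-- The order relation of `E(F)`: `G ≤ G'` if `G' = G'' ∘ G` for some `G''` in `E(F)`. -/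
def semigroupLE (F : Set (BM M)) (G G' : BM M) : Prop :=
  ∃ G'' ∈ semigroupOf F, G' = G'' ∘L G

/-- The filter of tails of the net `E(F)`, indexed by itself. -/
def semigroupTails (F : Set (BM M)) : Filter (semigroupOf F) :=
  ⨅ G : semigroupOf F, Filter.principal {G' | semigroupLE F G G'}

/-- The net `E(F)` converges weakly to `E`: `[l, G(X)] → [l, E(X)]` along the net, for every
`l ∈ M_*` and `X ∈ M`. -/
def WeaklyConverges (F : Set (BM M)) (E : BM M) : Prop :=
  ∀ l : predual M, ∀ X : Elem M,
    Filter.Tendsto (fun G : semigroupOf F => (l : Elem M →ₗ[ℂ] ℂ) ((G : BM M) X))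
      (semigroupTails F) (𝓝 ((l : Elem M →ₗ[ℂ] ℂ) (E X)))

end FiniteVN

end

/-! By weak* compactness, the bounded net `E(F)` has a point-ultraweak limit `E U` along every
ultrafilter `U`; the claim is that all ultrafilters finer than the tails give the same limit. Since
the τ-duals are bounded too, their limits supply an adjoint of `E U` for the pairing `τ (Z * X)`. By
`mem_Bhat_of_exists_adjoint` this puts `E U` in `Bhat τ`: the functionals `τ (Z * ·)` are norm dense
in the predual, which is norm closed.

Commuting idempotents absorb one another: G' ∘ G = G ∘ G' = G' once G ≤ G'. In the limit, G ∘ E U =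
E U = E U ∘ G for every G in `E(F)`. Taking limits in G again gives E U ∘ E V = E V by the first
equality, and E U ∘ E V = E U by the second together with the adjoint of `E U`. Hence E U = E V, and
V = U gives idempotence. Positivity survives because it is a closed condition on vector functionals.

Compactness, closedness and density all rest on presenting the predual as a quotient of ℓ¹(H × H)
whose dual is M. -/

noncomputable section

namespace FiniteVN

/-! ### The predual as a quotient of ℓ¹(H × H) -/

section

open scoped Classical

variable {H : Type*} [NormedAddCommGroup H] [InnerProductSpace ℂ H] [CompleteSpace H]
  {M : VonNeumannAlgebra H}

/-- The vector functional `A ↦ ⟨y, A x⟩`. -/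
def vecFunctional (M : VonNeumannAlgebra H) (x y : H) : Elem M →L[ℂ] ℂ :=
  LinearMap.mkContinuous
    { toFun := fun A => ⟪y, (A : H →L[ℂ] H) x⟫_ℂ
      map_add' := fun A B => by simp
      map_smul' := fun c A => by simp } (‖x‖ * ‖y‖) fun A => by
    have h1 := norm_inner_le_norm (𝕜 := ℂ) y ((A : H →L[ℂ] H) x)
    have h2 := (A : H →L[ℂ] H).le_opNorm x
    calc _ ≤ ‖y‖ * ‖(A : H →L[ℂ] H) x‖ := h1
      _ ≤ ‖y‖ * (‖(A : H →L[ℂ] H)‖ * ‖x‖) := by gcongr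
      _ = ‖x‖ * ‖y‖ * ‖A‖ := by rw [show ‖A‖ = ‖(A : H →L[ℂ] H)‖ from rfl]; ring

@[simp]
theorem vecFunctional_apply (x y : H) (A : Elem M) :
    vecFunctional M x y A = ⟪y, (A : H →L[ℂ] H) x⟫_ℂ := rfl

theorem norm_vecFunctional_le (x y : H) : ‖vecFunctional M x y‖ ≤ ‖x‖ * ‖y‖ :=
  LinearMap.mkContinuous_norm_le _ (by positivity) _

/-- The vector functional of the pair `i = (x, y)`, with `x` and `y` normalized. -/
def unitFunctional (M : VonNeumannAlgebra H) (i : H × H) : Elem M →L[ℂ] ℂ :=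
  ((‖i.1‖ * ‖i.2‖ : ℝ) : ℂ)⁻¹ • vecFunctional M i.1 i.2

theorem norm_unitFunctional_le (i : H × H) : ‖unitFunctional M i‖ ≤ 1 := by
  rw [unitFunctional, norm_smul, norm_inv, Complex.norm_real, Real.norm_of_nonneg (by positivity)]
  -- `inv_mul_le_one` also covers a zero vector, where the normalizing factor is `0⁻¹ = 0`.
  exact (mul_le_mul_of_nonneg_left (norm_vecFunctional_le _ _) (by positivity)).trans
    inv_mul_le_one

/-- The space `ℓ¹(H × H)`, of which the predual is a quotient. -/
abbrev PairSpace (H : Type*) : Type _ := lp (fun _ : H × H => ℂ) 1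

theorem PairSpace.hasSum_norm (p : PairSpace H) : HasSum (fun i => ‖p i‖) ‖p‖ := by
  simpa using lp.hasSum_norm (by simp) p

theorem PairSpace.summable_unitFunctional (p : PairSpace H) (A : Elem M) :
    Summable fun i => p i * unitFunctional M i A := by
  refine Summable.of_norm_bounded (p.hasSum_norm.summable.mul_right ‖A‖) fun i => ?_
  rw [norm_mul]
  gcongr
  simpa using (unitFunctional M i).le_of_opNorm_le (norm_unitFunctional_le i) A

/-- The quotient map from `ℓ¹(H × H)` onto the predual. -/
def toFunctional (M : VonNeumannAlgebra H) : PairSpace H →L[ℂ] (Elem M →L[ℂ] ℂ) :=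
  LinearMap.mkContinuous₂
    (LinearMap.mk₂ ℂ (fun p A => ∑' i, p i * unitFunctional M i A)
      (fun p q A => by
        rw [← (p.summable_unitFunctional A).tsum_add (q.summable_unitFunctional A)]
        simp [add_mul])
      (fun c p A => by
        rw [smul_eq_mul, ← tsum_mul_left]
        simp [mul_assoc])
      (fun p A B => by
        rw [← (p.summable_unitFunctional A).tsum_add (p.summable_unitFunctional B)]
        simp [mul_add])
      (fun c p A => by
        rw [smul_eq_mul, ← tsum_mul_left]
        simp [mul_left_comm])) 1 fun p A => by
    rw [LinearMap.mk₂_apply, one_mul]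
    refine tsum_of_norm_bounded (p.hasSum_norm.mul_right ‖A‖) fun i => ?_
    rw [norm_mul]
    gcongr
    simpa using (unitFunctional M i).le_of_opNorm_le (norm_unitFunctional_le i) A

theorem toFunctional_apply (p : PairSpace H) (A : Elem M) :
    toFunctional M p A = ∑' i, p i * unitFunctional M i A := rfl

theorem toFunctional_single (i : H × H) (c : ℂ) :
    toFunctional M (lp.single 1 i c) = c • unitFunctional M i := by
  ext A
  rw [toFunctional_apply, tsum_eq_single i]
  · simp
  · intro j hj
    simp [Pi.single_eq_of_ne hj]

/-- The element of `ℓ¹(H × H)` representing the vector functional `A ↦ ⟨y, A x⟩`. -/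
def pairVec (x y : H) : PairSpace H := lp.single 1 (x, y) ((‖x‖ * ‖y‖ : ℝ) : ℂ)

theorem norm_pairVec (x y : H) : ‖pairVec x y‖ = ‖x‖ * ‖y‖ := by
  rw [pairVec, lp.norm_single (by simp), Complex.norm_real, Real.norm_of_nonneg (by positivity)]

theorem toFunctional_pairVec (x y : H) : toFunctional M (pairVec x y) = vecFunctional M x y := by
  rw [pairVec, toFunctional_single, unitFunctional, smul_smul]
  by_cases h : ‖x‖ * ‖y‖ = 0
  · have := norm_vecFunctional_le (M := M) x y
    rw [h, norm_le_zero_iff] at this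
    rw [this]
    exact ContinuousLinearMap.ext fun A => by simp
  · rw [mul_inv_cancel₀ (by exact_mod_cast h), one_smul]

theorem toFunctional_pairVec_apply (x y : H) (A : Elem M) :
    toFunctional M (pairVec x y) A = ⟪y, (A : H →L[ℂ] H) x⟫_ℂ := by
  rw [toFunctional_pairVec, vecFunctional_apply]

/-- Two bounded functionals on `ℓ¹(H × H)` that vanish on the kernel of `toFunctional M` and agree
on the elements `pairVec x y` are equal. -/
theorem PairSpace.functional_ext {g g' : PairSpace H →L[ℂ] ℂ}
    (hg : ∀ p, toFunctional M p = 0 → g p = 0) (hg' : ∀ p, toFunctional M p = 0 → g' p = 0)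
    (h : ∀ x y, g (pairVec x y) = g' (pairVec x y)) : g = g' := by
  refine lp.ext_continuousLinearMap (by simp) fun i => ?_
  ext
  change g (lp.single 1 i 1) = g' (lp.single 1 i 1)
  by_cases hi : ((‖i.1‖ * ‖i.2‖ : ℝ) : ℂ) = 0
  · have : toFunctional M (lp.single 1 i (1 : ℂ)) = 0 := by
      rw [toFunctional_single, unitFunctional, hi]
      exact ContinuousLinearMap.ext fun A => by simp
    rw [hg _ this, hg' _ this]
  · have : lp.single 1 i (1 : ℂ) = (((‖i.1‖ * ‖i.2‖ : ℝ) : ℂ))⁻¹ • pairVec i.1 i.2 := by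
      rw [pairVec, ← lp.single_smul, smul_eq_mul, inv_mul_cancel₀ hi]
    rw [this, map_smul, map_smul, h]

/-! ### Duality between M and the predual -/

/-- `M` is the dual of its predual. -/
theorem exists_elem_of_functional (g : PairSpace H →L[ℂ] ℂ)
    (hg : ∀ p, toFunctional M p = 0 → g p = 0) :
    ∃ A : Elem M, ‖A‖ ≤ ‖g‖ ∧ ∀ p, g p = toFunctional M p A := by
  have hsub : ∀ p q, toFunctional M p = toFunctional M q → g p = g q := fun p q h => by
    rw [← sub_eq_zero, ← map_sub]
    exact hg _ (by rw [map_sub, h, sub_self])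
  -- `pairVec` is sesquilinear only modulo the kernel of `toFunctional M`; as `g` vanishes there,
  -- the form is sesquilinear and bounded.
  let B : H →L⋆[ℂ] H →L[ℂ] ℂ := LinearMap.mkContinuous₂
    (LinearMap.mk₂'ₛₗ (starRingEnd ℂ) (RingHom.id ℂ) (fun y x => g (pairVec x y))
      (fun y y' x => by
        rw [← map_add]; apply hsub; ext A; simp [toFunctional_pairVec])
      (fun c y x => by
        rw [← map_smul]; apply hsub; ext A; simp [toFunctional_pairVec, mul_comm])
      (fun y x x' => by
        rw [← map_add]; apply hsub; ext A; simp [toFunctional_pairVec])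
      (fun c y x => by
        rw [RingHom.id_apply, ← map_smul]; apply hsub; ext A
        simp [toFunctional_pairVec])) ‖g‖ fun y x => by
    rw [LinearMap.mk₂'ₛₗ_apply]
    calc _ ≤ ‖g‖ * ‖pairVec x y‖ := g.le_opNorm _
      _ = ‖g‖ * ‖y‖ * ‖x‖ := by rw [norm_pairVec]; ring
  let T : H →L[ℂ] H := ContinuousLinearMap.adjoint
    (InnerProductSpace.continuousLinearMapOfBilin B)
  have hT : ∀ x y, ⟪y, T x⟫_ℂ = g (pairVec x y) := fun x y => by
    rw [ContinuousLinearMap.adjoint_inner_right,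
      InnerProductSpace.continuousLinearMapOfBilin_apply]
    rfl
  -- Double commutant: for S in the commutant, `pairVec (S x) y` and `pairVec x (S* y)` represent
  -- the same functional on M, so `g` agrees on them and T commutes with S.
  have hTM : T ∈ M := by
    rw [← M.commutant_commutant, VonNeumannAlgebra.mem_commutant_iff]
    intro S hS
    rw [VonNeumannAlgebra.mem_commutant_iff] at hS
    ext x
    refine ext_inner_left ℂ fun y => ?_
    rw [mul_apply_eq_comp, mul_apply_eq_comp, hT,
      ← ContinuousLinearMap.adjoint_inner_left, hT]
    apply hsub
    ext A
    rw [toFunctional_pairVec_apply, toFunctional_pairVec_apply,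
      ContinuousLinearMap.adjoint_inner_left, ← mul_apply_eq_comp,
      ← mul_apply_eq_comp, hS A A.2]
  have hTn : ‖T‖ ≤ ‖g‖ := by
    refine ContinuousLinearMap.opNorm_le_of_re_inner_le (norm_nonneg g) fun x y hx hy => ?_
    rw [← inner_conj_symm, hT, RCLike.conj_re]
    refine (RCLike.re_le_norm _).trans ((g.le_opNorm _).trans ?_)
    rw [norm_pairVec, hx, hy, mul_one, mul_one]
  refine ⟨⟨T, hTM⟩, hTn, fun p => ?_⟩
  refine DFunLike.congr_fun (PairSpace.functional_ext (M := M) (g := g)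
    (g' := (toFunctional M).flip ⟨T, hTM⟩) hg (fun p hp => ?_) fun x y => ?_) p
  · rw [ContinuousLinearMap.flip_apply, hp]; rfl
  · rw [ContinuousLinearMap.flip_apply, toFunctional_pairVec_apply, ← hT]

theorem norm_toFunctional_le (p : PairSpace H) : ‖toFunctional M p‖ ≤ ‖p‖ := by
  simpa using (toFunctional M).le_of_opNorm_le
    (LinearMap.mkContinuous₂_norm_le _ zero_le_one _) p

theorem norm_toFunctional_apply_le (p : PairSpace H) (A : Elem M) :
    ‖toFunctional M p A‖ ≤ ‖p‖ * ‖A‖ :=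
  (toFunctional M p).le_of_opNorm_le (norm_toFunctional_le p) A

/-- A functional of norm at most one that vanishes on `S` and computes the distance of `p`
to `S`. -/
theorem exists_functional_vanishing_on {V : Type*} [NormedAddCommGroup V] [NormedSpace ℂ V]
    (S : Submodule ℂ V) (p : V) :
    ∃ g : V →L[ℂ] ℂ, ‖g‖ ≤ 1 ∧ (∀ s ∈ S, g s = 0) ∧ g p = (‖S.mkQ p‖ : ℂ) := by
  obtain ⟨g, hg, hgp⟩ : ∃ g : StrongDual ℂ (V ⧸ S), ‖g‖ ≤ 1 ∧ g (S.mkQ p) = (‖S.mkQ p‖ : ℂ) := by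
    by_cases h : ‖S.mkQ p‖ = 0
    · exact ⟨0, ContinuousLinearMap.opNorm_zero.trans_le zero_le_one, by rw [h]; rfl⟩
    · obtain ⟨g, hg, hgp⟩ := exists_dual_vector ℂ (S.mkQ p) h
      exact ⟨g, hg.le, hgp⟩
  refine ⟨g ∘L S.mkQL, ?_, fun s hs => ?_, hgp⟩
  · refine ContinuousLinearMap.opNorm_le_bound _ zero_le_one fun v => ?_
    refine (g.le_of_opNorm_le hg _).trans ?_
    rw [one_mul, one_mul]
    exact Submodule.Quotient.norm_mk_le S v
  · have : S.mkQ s = 0 := by simpa using hs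
    simp [this]

/-- A Hahn–Banach functional norming the class of `p` modulo the kernel is evaluation at an element
of the unit ball of M, so the quotient norm is at most the norm of the functional. The factor 2 is
slack, as the infimum over representatives need not be attained. -/
theorem exists_norm_le_of_toFunctional (p : PairSpace H) :
    ∃ q : PairSpace H, toFunctional M q = toFunctional M p ∧ ‖q‖ ≤ 2 * ‖toFunctional M p‖ := by
  set S : Submodule ℂ (PairSpace H) := LinearMap.ker (toFunctional M).toLinearMap with hS
  by_cases h0 : toFunctional M p = 0
  · exact ⟨0, by simp [h0], by simp⟩
  have hle : ‖S.mkQ p‖ ≤ ‖toFunctional M p‖ := by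
    obtain ⟨g, hg, hgS, hgp⟩ := exists_functional_vanishing_on S p
    obtain ⟨A, hA, hgA⟩ := exists_elem_of_functional (M := M) g fun q hq => hgS q hq
    have h1 : ‖g p‖ = ‖S.mkQ p‖ := by rw [hgp]; simp
    rw [← h1, hgA]
    calc _ ≤ ‖toFunctional M p‖ * ‖A‖ := (toFunctional M p).le_opNorm A
      _ ≤ ‖toFunctional M p‖ * 1 := by gcongr; exact hA.trans hg
      _ = _ := mul_one _
  obtain ⟨q, hq, hqn⟩ := Submodule.Quotient.norm_mk_lt (S := S) (S.mkQ p) (norm_pos_iff.mpr h0)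
  refine ⟨q, ?_, by linarith⟩
  have : q - p ∈ S := (Submodule.Quotient.eq S).mp hq
  rw [hS, LinearMap.mem_ker] at this
  rw [← sub_eq_zero, ← map_sub]
  exact this

/-- The predual is closed in the dual of `M`. -/
theorem isClosed_range_toFunctional : IsClosed (Set.range (toFunctional M)) := by
  let f : NormedAddGroupHom (PairSpace H) (Elem M →L[ℂ] ℂ) :=
    (toFunctional M).toLinearMap.toAddMonoidHom.mkNormedAddGroupHom 1 fun p => by
      simpa using norm_toFunctional_le p
  have hf : ∀ p, f p = toFunctional M p := fun p => rfl
  have hsurj : f.SurjectiveOnWith f.range 2 := by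
    rintro _ ⟨p, rfl⟩
    exact exists_norm_le_of_toFunctional p
  have := controlled_closure_of_complete two_pos one_pos hsurj
  rw [← closure_subset_iff_isClosed]
  intro l hl
  obtain ⟨p, hp, -⟩ := this l hl
  exact ⟨p, hp⟩

/-! ### Ultraweakly continuous functionals and ℓ¹(H × H) -/

theorem exists_toFunctional_eq_tsum (x y : ℕ → H) (hx : Summable fun n => ‖x n‖ ^ 2)
    (hy : Summable fun n => ‖y n‖ ^ 2) :
    ∃ p : PairSpace H, ∀ A : Elem M,
      toFunctional M p A = ∑' n, ⟪y n, (A : H →L[ℂ] H) (x n)⟫_ℂ := by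
  have hsum : Summable fun n => pairVec (x n) (y n) := by
    refine Summable.of_norm_bounded (hx.add hy) fun n => ?_
    rw [norm_pairVec]
    nlinarith [sq_nonneg (‖x n‖ - ‖y n‖), sq_nonneg ‖x n‖, sq_nonneg ‖y n‖]
  refine ⟨∑' n, pairVec (x n) (y n), fun A => ?_⟩
  have h := hsum.hasSum.mapL ((toFunctional M).flip A)
  simp only [ContinuousLinearMap.flip_apply, toFunctional_pairVec_apply] at h
  exact h.tsum_eq.symm

theorem continuous_tsum_inner_ultraweak (x y : ℕ → H) (hx : Summable fun n => ‖x n‖ ^ 2)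
    (hy : Summable fun n => ‖y n‖ ^ 2) : Continuous[ultraweak M, inferInstance]
      (fun A : Elem M => ∑' n, ⟪y n, (A : H →L[ℂ] H) (x n)⟫_ℂ) :=
  continuous_iInf_dom (i := x) (continuous_iInf_dom (i := y)
    (continuous_iInf_dom (i := hx) (continuous_iInf_dom (i := hy) continuous_induced_dom)))

/-- An ℓ¹ element has countable support, which injects into ℕ. Splitting each coefficient as (p /
√|p|) · √|p| makes both sequences square summable; they are extended by zero. -/
theorem exists_sequences_of_toFunctional (p : PairSpace H) :
    ∃ x y : ℕ → H, (Summable fun n => ‖x n‖ ^ 2) ∧ (Summable fun n => ‖y n‖ ^ 2) ∧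
      ∀ A : Elem M, toFunctional M p A = ∑' n, ⟪y n, (A : H →L[ℂ] H) (x n)⟫_ℂ := by
  have hcount : (Function.support p).Countable := by
    have := p.hasSum_norm.summable.countable_support
    refine this.mono fun i hi => ?_
    simpa using hi
  obtain ⟨e, he⟩ := hcount.to_subtype.exists_injective_nat
  let s : H × H → ℂ := fun i => (Real.sqrt ‖p i‖ : ℂ)
  have hs : ∀ i, s i * s i = ‖p i‖ := fun i => by
    rw [← Complex.ofReal_mul, Real.mul_self_sqrt (norm_nonneg _)]
  have hsn : ∀ i, ‖s i‖ ^ 2 = ‖p i‖ := fun i => by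
    rw [Complex.norm_real, Real.norm_of_nonneg (Real.sqrt_nonneg _), Real.sq_sqrt (norm_nonneg _)]
  have hunit : ∀ x : H, ‖((‖x‖ : ℂ)⁻¹ • x)‖ ≤ 1 := fun x => by
    rw [norm_smul, norm_inv, Complex.norm_real, norm_norm]
    exact inv_mul_le_one
  let X : Function.support p → H := fun i => (p i / s i) • ((‖i.1.1‖ : ℂ)⁻¹ • i.1.1)
  let Y : Function.support p → H := fun i => s i • ((‖i.1.2‖ : ℂ)⁻¹ • i.1.2)
  have hps : ∀ i, ‖p i / s i‖ ^ 2 = ‖p i‖ := fun i => by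
    rw [norm_div, div_pow, hsn, sq, mul_self_div_self]
  have hsum : Summable fun i : Function.support p => ‖p i‖ :=
    p.hasSum_norm.summable.subtype _
  have hX : Summable fun i => ‖X i‖ ^ 2 := by
    refine hsum.of_nonneg_of_le (fun i => by positivity) fun i => ?_
    rw [norm_smul, mul_pow, hps]
    exact mul_le_of_le_one_right (norm_nonneg _) (pow_le_one₀ (norm_nonneg _) (hunit _))
  have hY : Summable fun i => ‖Y i‖ ^ 2 := by
    refine hsum.of_nonneg_of_le (fun i => by positivity) fun i => ?_
    rw [norm_smul, mul_pow, hsn]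
    exact mul_le_of_le_one_right (norm_nonneg _) (pow_le_one₀ (norm_nonneg _) (hunit _))
  have hext : ∀ Z : Function.support p → H, (fun n => ‖Function.extend e Z 0 n‖ ^ 2)
      = Function.extend e (fun i => ‖Z i‖ ^ 2) 0 := fun Z => by
    funext n
    by_cases h : ∃ i, e i = n
    · obtain ⟨i, rfl⟩ := h
      simp [he.extend_apply]
    · simp [Function.extend_apply' _ _ _ h]
  refine ⟨Function.extend e X 0, Function.extend e Y 0, ?_, ?_, fun A => ?_⟩
  · rw [hext]; exact (summable_extend_zero he).mpr hX
  · rw [hext]; exact (summable_extend_zero he).mpr hY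
  have hprod : (fun n => ⟪Function.extend e Y 0 n, (A : H →L[ℂ] H) (Function.extend e X 0 n)⟫_ℂ)
      = Function.extend e (fun i => ⟪Y i, (A : H →L[ℂ] H) (X i)⟫_ℂ) 0 := by
    funext n
    by_cases h : ∃ i, e i = n
    · obtain ⟨i, rfl⟩ := h
      simp [he.extend_apply]
    · simp [Function.extend_apply' _ _ _ h]
  rw [hprod, tsum_extend_zero he, toFunctional_apply,
    ← tsum_subtype_eq_of_support_subset (s := Function.support p) fun i hi => left_ne_zero_of_mul hi]
  refine tsum_congr fun i => ?_
  have hsi : s i ≠ 0 := fun h => i.2 (by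
    have := hs i; rw [h] at this; simpa using this.symm)
  have hconj : (starRingEnd ℂ) (s i) = s i := Complex.conj_ofReal _
  simp only [X, Y, unitFunctional, map_smul, inner_smul_left, inner_smul_right, hconj, map_inv₀,
    Complex.conj_ofReal, smul_apply, vecFunctional_apply, smul_eq_mul]
  push_cast
  field_simp

/-- The predual is the image of `ℓ¹(H × H)`. -/
theorem mem_predual_iff {l : Elem M →ₗ[ℂ] ℂ} :
    l ∈ predual M ↔ ∃ p : PairSpace H, ∀ A, toFunctional M p A = l A := by
  constructor
  · intro hl
    let ι := {z : (ℕ → H) × (ℕ → H) //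
      (Summable fun n => ‖z.1 n‖ ^ 2) ∧ Summable fun n => ‖z.2 n‖ ^ 2}
    choose P hP using fun z : ι => exists_toFunctional_eq_tsum (M := M) z.1.1 z.1.2 z.2.1 z.2.2
    have hspan : ∀ l ∈ Submodule.span ℂ (Set.range fun z => (toFunctional M (P z)).toLinearMap),
        ∃ p : PairSpace H, ∀ A, toFunctional M p A = l A := by
      intro l hl
      induction hl using Submodule.span_induction with
      | mem l h => obtain ⟨z, rfl⟩ := h; exact ⟨P z, fun A => rfl⟩
      | zero => exact ⟨0, fun A => by simp⟩
      | add l l' _ _ h h' =>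
        obtain ⟨p, hp⟩ := h
        obtain ⟨p', hp'⟩ := h'
        exact ⟨p + p', fun A => by simp [hp, hp']⟩
      | smul c l _ h =>
        obtain ⟨p, hp⟩ := h
        exact ⟨c • p, fun A => by simp [hp]⟩
    have hfun : ∀ z : ι, (fun A : Elem M => ∑' n, ⟪z.1.2 n, (A : H →L[ℂ] H) (z.1.1 n)⟫_ℂ)
        = ⇑(toFunctional M (P z)).toLinearMap := fun z => funext fun A => (hP z A).symm
    have htop : ultraweak M = ⨅ z : ι,
        TopologicalSpace.induced ⇑(toFunctional M (P z)).toLinearMap inferInstance := by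
      simp only [← hfun, ultraweak, ι, iInf_subtype, iInf_prod, iInf_and]
    have hl' : Continuous[ultraweak M, inferInstance] l := hl
    -- A functional continuous for the topology induced by a family of functionals is a finite
    -- linear combination of them.
    rw [htop, ← LinearMap.mem_span_iff_continuous] at hl'
    exact hspan l hl'
  · rintro ⟨p, hp⟩
    obtain ⟨x, y, hx, hy, h⟩ := exists_sequences_of_toFunctional (M := M) p
    have : ⇑l = fun A : Elem M => ∑' n, ⟪y n, (A : H →L[ℂ] H) (x n)⟫_ℂ :=
      funext fun A => by rw [← hp, h]
    change Continuous[ultraweak M, inferInstance] l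
    rw [this]
    exact continuous_tsum_inner_ultraweak x y hx hy

end

variable {H : Type*} [NormedAddCommGroup H] [InnerProductSpace ℂ H] [CompleteSpace H]
  {M : VonNeumannAlgebra H}

/-! ### Ultraweak continuity and the trace pairing -/

theorem toFunctional_mem_predual (p : PairSpace H) :
    (toFunctional M p).toLinearMap ∈ predual M :=
  mem_predual_iff.mpr ⟨p, fun _ => rfl⟩

theorem mem_Bw_of_forall {φ : BM M}
    (h : ∀ p : PairSpace H, ∃ q : PairSpace H, toFunctional M p ∘L φ = toFunctional M q) :
    φ ∈ Bw M := by
  change Continuous[ultraweak M, ultraweak M] φ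
  refine continuous_iInf_rng.2 fun x => continuous_iInf_rng.2 fun y => continuous_iInf_rng.2
    fun hx => continuous_iInf_rng.2 fun hy => continuous_induced_rng.2 ?_
  obtain ⟨p, hp⟩ := exists_toFunctional_eq_tsum (M := M) x y hx hy
  obtain ⟨q, hq⟩ := h p
  have : ((fun A : Elem M => ∑' n, ⟪y n, (A : H →L[ℂ] H) (x n)⟫_ℂ) ∘ φ)
      = ⇑(toFunctional M q).toLinearMap := by
    funext A
    rw [Function.comp_apply, ← hp]
    exact DFunLike.congr_fun hq A
  rw [this]
  exact toFunctional_mem_predual q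

theorem elem_ext_of_predual {A B : Elem M} (h : ∀ l ∈ predual M, l A = l B) : A = B := by
  refine Subtype.ext (ContinuousLinearMap.ext fun x => ext_inner_left ℂ fun y => ?_)
  rw [← toFunctional_pairVec_apply, ← toFunctional_pairVec_apply]
  exact h _ (toFunctional_mem_predual _)

theorem comp_mem_predual {φ : BM M} (hφ : φ ∈ Bw M) {l : Elem M →ₗ[ℂ] ℂ} (hl : l ∈ predual M) :
    l ∘ₗ φ.toLinearMap ∈ predual M :=
  (preadjoint φ hφ ⟨l, hl⟩).2

variable (τ : FaithfulNormalTrace M)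

theorem trace_mul_left_mem_predual (Z : Elem M) : τ.toFun ∘ₗ LinearMap.mulLeft ℂ Z ∈ predual M :=
  (Psi τ Z).2

theorem trace_mul_right_mem_predual (Z : Elem M) :
    τ.toFun ∘ₗ LinearMap.mulRight ℂ Z ∈ predual M := by
  convert trace_mul_left_mem_predual τ Z using 1
  ext A
  exact τ.trace_comm A Z

theorem eq_zero_of_trace_mul {A : Elem M} (h : ∀ Z, τ.toFun (Z * A) = 0) : A = 0 := by
  refine Psi_injective τ ?_
  rw [map_zero]
  ext Z
  rw [Psi_apply, τ.trace_comm, h]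
  rfl

theorem eq_of_trace_mul {A B : Elem M} (h : ∀ Z, τ.toFun (Z * A) = τ.toFun (Z * B)) : A = B := by
  rw [← sub_eq_zero]
  refine eq_zero_of_trace_mul τ fun Z => ?_
  rw [mul_sub, map_sub, h, sub_self]

/-- The elements of `ℓ¹(H × H)` that represent functionals `A ↦ τ (Z A)`. -/
def traceRepresentable : Submodule ℂ (PairSpace H) where
  carrier := {p | ∃ Z : Elem M, ∀ A, toFunctional M p A = τ.toFun (Z * A)}
  zero_mem' := ⟨0, fun A => by simp⟩
  add_mem' := by
    rintro p q ⟨Z, hZ⟩ ⟨W, hW⟩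
    exact ⟨Z + W, fun A => by simp [hZ, hW, add_mul]⟩
  smul_mem' := by
    rintro c p ⟨Z, hZ⟩
    exact ⟨c • Z, fun A => by simp [hZ]⟩

/-- The kernel of `toFunctional M` lies in this subspace (take Z = 0), so a functional annihilating
the subspace is evaluation at some A in M. Then τ(Z A) = 0 for all Z, and faithfulness forces A = 0.
-/
theorem dense_traceRepresentable : Dense (traceRepresentable τ : Set (PairSpace H)) := by
  intro p
  set S := traceRepresentable τ
  obtain ⟨g, -, hgS, hgp⟩ := exists_functional_vanishing_on S p
  obtain ⟨A, -, hA⟩ := exists_elem_of_functional (M := M) g fun q hq =>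
    hgS q ⟨0, fun A => by simp [hq]⟩
  have hA0 : A = 0 := eq_zero_of_trace_mul τ fun Z => by
    obtain ⟨q, hq⟩ := mem_predual_iff.mp (trace_mul_left_mem_predual τ Z)
    have := hgS q ⟨Z, hq⟩
    rw [hA, hq] at this
    exact this
  rw [hA, hA0, map_zero] at hgp
  have hnorm : ‖S.mkQ p‖ = 0 := by exact_mod_cast hgp.symm
  exact (QuotientAddGroup.norm_mk_eq_zero_iff_mem_closure (S := S.toAddSubgroup)).mp hnorm

/-- A bounded operator on `M` that has an adjoint with respect to `τ` is `τ`-`M`-stable, and in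
particular ultraweakly continuous. -/
theorem mem_Bhat_of_exists_adjoint {φ : BM M}
    (h : ∀ Z, ∃ Z', ∀ X, τ.toFun (Z * φ X) = τ.toFun (Z' * X)) : φ ∈ Bhat τ := by
  have hBw : φ ∈ Bw M := by
    refine mem_Bw_of_forall fun p => ?_
    have hcont : Continuous fun q : PairSpace H => toFunctional M q ∘L φ :=
      (ContinuousLinearMap.compL ℂ (Elem M) (Elem M) ℂ).flip φ |>.continuous.comp
        (toFunctional M).continuous
    -- On the dense subspace the adjoint keeps the composite in the predual; norm continuity carries
    -- this to the closure.
    have hmem : toFunctional M p ∘L φ ∈ closure (Set.range (toFunctional M)) := by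
      refine map_mem_closure (f := fun q => toFunctional M q ∘L φ) hcont (dense_traceRepresentable τ p) ?_
      rintro q ⟨Z, hZ⟩
      obtain ⟨Z', hZ'⟩ := h Z
      obtain ⟨r, hr⟩ := mem_predual_iff.mp (trace_mul_left_mem_predual τ Z')
      refine ⟨r, ?_⟩
      ext A
      rw [hr, ContinuousLinearMap.comp_apply, hZ, hZ']
      rfl
    rw [isClosed_range_toFunctional.closure_eq] at hmem
    obtain ⟨q, hq⟩ := hmem
    exact ⟨q, hq.symm⟩
  refine ⟨hBw, ?_⟩
  rintro _ ⟨Z, rfl⟩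
  obtain ⟨Z', hZ'⟩ := h Z
  refine ⟨Z', ?_⟩
  ext A
  exact (hZ' A).symm

variable {τ}

/-! ### Limits along ultrafilters -/

/-- Bounded families in `M` have ultraweak limits along ultrafilters. -/
theorem exists_ultraweak_limit {ι : Type*} (U : Ultrafilter ι) {a : ι → Elem M} {C : ℝ}
    (hC : ∀ i, ‖a i‖ ≤ C) :
    ∃ A : Elem M, ‖A‖ ≤ C ∧
      ∀ l ∈ predual M, Filter.Tendsto (fun i => l (a i)) U (𝓝 (l A)) := by
  obtain ⟨i₀⟩ := U.neBot.nonempty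
  have hC0 : 0 ≤ C := (norm_nonneg _).trans (hC i₀)
  -- Banach–Alaoglu by hand: the scalar limits form a bounded functional of `p` that vanishes on the
  -- kernel, hence come from an element of M.
  have hlim : ∀ p : PairSpace H, ∃ c : ℂ,
      ‖c‖ ≤ C * ‖p‖ ∧ Filter.Tendsto (fun i => toFunctional M p (a i)) U (𝓝 c) := by
    intro p
    obtain ⟨c, hc, hle⟩ := (isCompact_closedBall (0 : ℂ) (C * ‖p‖)).ultrafilter_le_nhds
      (U.map fun i => toFunctional M p (a i)) (by
        rw [Filter.le_principal_iff]
        refine Filter.mem_map.mpr (Filter.univ_mem' fun i => ?_)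
        change toFunctional M p (a i) ∈ Metric.closedBall 0 _
        rw [mem_closedBall_zero_iff, mul_comm]
        exact (norm_toFunctional_apply_le p (a i)).trans (by gcongr; exact hC i))
    exact ⟨c, by simpa using hc, hle⟩
  choose g hg hlim using hlim
  let G : PairSpace H →L[ℂ] ℂ := LinearMap.mkContinuous
    { toFun := g
      map_add' := fun p q => by
        refine tendsto_nhds_unique (hlim (p + q)) ?_
        simpa using (hlim p).add (hlim q)
      map_smul' := fun c p => by
        refine tendsto_nhds_unique (hlim (c • p)) ?_
        simpa using (hlim p).const_mul c } C hg
  obtain ⟨A, hA, hGA⟩ := exists_elem_of_functional (M := M) G fun p hp => by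
    refine tendsto_nhds_unique (hlim p) ?_
    simp [hp]
  refine ⟨A, hA.trans (LinearMap.mkContinuous_norm_le _ hC0 _), fun l hl => ?_⟩
  obtain ⟨p, hp⟩ := mem_predual_iff.mp hl
  simp only [← hp, ← hGA]
  exact hlim p

/-- Uniformly bounded families of operators on `M` have point-ultraweak limits along
ultrafilters. -/
theorem exists_pointwise_ultraweak_limit {ι : Type*} (U : Ultrafilter ι) {G : ι → BM M} {C : ℝ}
    (hC : ∀ i, ‖G i‖ ≤ C) :
    ∃ E : BM M, ∀ l ∈ predual M, ∀ X,
      Filter.Tendsto (fun i => l (G i X)) U (𝓝 (l (E X))) := by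
  choose E hE hlim using fun X => exists_ultraweak_limit U (a := fun i => G i X) (C := C * ‖X‖)
    fun i => (G i).le_of_opNorm_le (hC i) X
  refine ⟨LinearMap.mkContinuous
    { toFun := E
      map_add' := fun X Y => elem_ext_of_predual fun l hl => by
        refine tendsto_nhds_unique (hlim (X + Y) l hl) ?_
        simpa using (hlim X l hl).add (hlim Y l hl)
      map_smul' := fun c X => elem_ext_of_predual fun l hl => by
        refine tendsto_nhds_unique (hlim (c • X) l hl) ?_
        simpa using (hlim X l hl).const_mul c } C hE, fun l hl X => hlim X l hl⟩

/-! ### The semigroup of commuting projections and its tails -/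

variable {F : Set (BM M)}

theorem trace_tauDual {φ : BM M} (hφ : φ ∈ Bhat τ) (Z X : Elem M) :
    τ.toFun (tauDual τ φ hφ Z * X) = τ.toFun (Z * φ X) := by
  have h : Psi τ (tauDual τ φ hφ Z) = preadjoint φ hφ.1 (Psi τ Z) :=
    congrArg Subtype.val ((LinearEquiv.ofInjective (Psi τ) (Psi_injective τ)).apply_symm_apply _)
  exact DFunLike.congr_fun (congrArg Subtype.val h) X

theorem semigroupOf_comm_of_forall_comm {ψ G : BM M} (hG : G ∈ semigroupOf F)
    (h : ∀ φ ∈ F, φ ∘L ψ = ψ ∘L φ) : G ∘L ψ = ψ ∘L G := by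
  induction hG with
  | of hφ => exact h _ hφ
  | comp hφ _ ih =>
    rw [ContinuousLinearMap.comp_assoc, ih, ← ContinuousLinearMap.comp_assoc, h _ hφ,
      ContinuousLinearMap.comp_assoc]

theorem semigroupOf_comm (hcomm : ∀ φ ∈ F, ∀ ψ ∈ F, φ ∘L ψ = ψ ∘L φ) {G G' : BM M}
    (hG : G ∈ semigroupOf F) (hG' : G' ∈ semigroupOf F) : G ∘L G' = G' ∘L G :=
  semigroupOf_comm_of_forall_comm hG fun _ hφ =>
    (semigroupOf_comm_of_forall_comm hG' fun _ hψ => hcomm _ hψ _ hφ).symm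

theorem semigroupOf_idempotent (hcomm : ∀ φ ∈ F, ∀ ψ ∈ F, φ ∘L ψ = ψ ∘L φ)
    (hproj : ∀ φ ∈ F, φ ∘L φ = φ) {G : BM M} (hG : G ∈ semigroupOf F) : G ∘L G = G := by
  induction hG with
  | of hφ => exact hproj _ hφ
  | @comp φ G hφ hG ih =>
    rw [ContinuousLinearMap.comp_assoc, ← ContinuousLinearMap.comp_assoc G,
      semigroupOf_comm hcomm hG (.of hφ), ContinuousLinearMap.comp_assoc, ih,
      ← ContinuousLinearMap.comp_assoc, hproj _ hφ]

theorem semigroupOf_comp_mem {G G' : BM M} (hG : G ∈ semigroupOf F) (hG' : G' ∈ semigroupOf F) :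
    G ∘L G' ∈ semigroupOf F := by
  induction hG with
  | of hφ => exact .comp hφ hG'
  | comp hφ _ ih =>
    rw [ContinuousLinearMap.comp_assoc]
    exact .comp hφ ih

theorem IsNPositive.comp {n : ℕ} {φ ψ : BM M} (hφ : IsNPositive n φ) (hψ : IsNPositive n ψ) :
    IsNPositive n (φ ∘L ψ) :=
  fun A hA => hφ _ (hψ A hA)

theorem isNPositive_of_mem_semigroupOf {n : ℕ} (h : ∀ φ ∈ F, IsNPositive n φ) {G : BM M}
    (hG : G ∈ semigroupOf F) : IsNPositive n G := by
  induction hG with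
  | of hφ => exact h _ hφ
  | comp hφ _ ih => exact (h _ hφ).comp ih

theorem eventually_semigroupLE {G : BM M} (hG : G ∈ semigroupOf F) :
    ∀ᶠ G' : semigroupOf F in semigroupTails F, semigroupLE F G G' :=
  Filter.mem_iInf_of_mem (⟨G, hG⟩ : semigroupOf F) (Filter.mem_principal_self _)

/-- By commutativity G ∘ G' lies above both G and G', so the tails are directed. Idempotence gives G
≤ G, so no tail is empty; the semigroup need not contain the identity. -/
theorem semigroupTails_neBot (hcomm : ∀ φ ∈ F, ∀ ψ ∈ F, φ ∘L ψ = ψ ∘L φ)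
    (hproj : ∀ φ ∈ F, φ ∘L φ = φ) (hF : F.Nonempty) : (semigroupTails F).NeBot := by
  obtain ⟨φ, hφ⟩ := hF
  have : Nonempty (semigroupOf F) := ⟨⟨φ, .of hφ⟩⟩
  refine Filter.iInf_neBot_of_directed (fun G G' => ?_) fun G => ?_
  · refine ⟨⟨G ∘L G', semigroupOf_comp_mem G.2 G'.2⟩, ?_, ?_⟩ <;>
      refine Filter.principal_mono.mpr ?_
    · rintro _ ⟨K, hK, h⟩
      refine ⟨K ∘L G', semigroupOf_comp_mem hK G'.2, ?_⟩
      rw [h, ContinuousLinearMap.comp_assoc, ← semigroupOf_comm hcomm G.2 G'.2]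
    · rintro _ ⟨K, hK, h⟩
      exact ⟨K ∘L G, semigroupOf_comp_mem hK G.2, h⟩
  · exact Filter.principal_neBot_iff.mpr ⟨G, G, G.2, (semigroupOf_idempotent hcomm hproj G.2).symm⟩

/-! ### Positivity of operator matrices under limits -/

theorem inner_matrixOp {n : ℕ} (A : Matrix (Fin n) (Fin n) (H →L[ℂ] H))
    (ξ : PiLp 2 (fun _ : Fin n => H)) :
    ⟪matrixOp A ξ, ξ⟫_ℂ = ∑ i, ∑ j, starRingEnd ℂ ⟪ξ i, A i j (ξ j)⟫_ℂ := by
  simp [matrixOp, PiLp.inner_apply, sum_inner]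

theorem isPositive_matrixOp_iff {n : ℕ} (A : Matrix (Fin n) (Fin n) (H →L[ℂ] H)) :
    (matrixOp A).IsPositive ↔ ∀ ξ : PiLp 2 (fun _ : Fin n => H),
      0 ≤ ∑ i, ∑ j, starRingEnd ℂ ⟪ξ i, A i j (ξ j)⟫_ℂ := by
  simp only [← inner_matrixOp]
  refine ⟨fun h => h.inner_nonneg_left, fun h => ?_⟩
  -- Over ℂ a nonnegative quadratic form already forces self-adjointness.
  rw [ContinuousLinearMap.isPositive_iff_complex]
  intro ξ
  obtain ⟨hre, him⟩ := Complex.nonneg_iff.mp (h ξ)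
  exact ⟨Complex.ext (by simp) (by simp [← him]), hre⟩

/-- Point-ultraweak limits of `n`-positive operators are `n`-positive. -/
theorem isNPositive_of_tendsto {n : ℕ} {ι : Type*} {u : Filter ι} [u.NeBot] {G : ι → BM M}
    {E : BM M} (hG : ∀ i, IsNPositive n (G i))
    (hlim : ∀ l ∈ predual M, ∀ X, Filter.Tendsto (fun i => l (G i X)) u (𝓝 (l (E X)))) :
    IsNPositive n E := by
  intro A hA
  rw [isPositive_matrixOp_iff]
  intro ξ
  refine ge_of_tendsto' (x := u) (f := fun k => ∑ i, ∑ j,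
    starRingEnd ℂ ⟪ξ i, (G k (A i j) : H →L[ℂ] H) (ξ j)⟫_ℂ) ?_ fun k =>
      (isPositive_matrixOp_iff _).mp (hG k A hA) ξ
  refine tendsto_finsetSum _ fun i _ => tendsto_finsetSum _ fun j _ => ?_
  refine (Complex.continuous_conj.tendsto _).comp ?_
  have := hlim _ (toFunctional_mem_predual (pairVec (ξ j) (ξ i))) (A i j)
  simp only [ContinuousLinearMap.coe_coe, toFunctional_pairVec_apply] at this
  exact this

end FiniteVN

end

/-! ### Convergence of the net -/

open FiniteVN

theorem proposition2p6 {H : Type*} [NormedAddCommGroup H] [InnerProductSpace ℂ H]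
    [CompleteSpace H] [TopologicalSpace.SeparableSpace H]
    (M : VonNeumannAlgebra H) (τ : FiniteVN.FaithfulNormalTrace M)
    (m : ℕ) (hm : 2 ≤ m) (F : Set (FiniteVN.BM M)) (hF : F ⊆ FiniteVN.Bhat τ)
    (hcomm : ∀ φ ∈ F, ∀ ψ ∈ F, φ ∘L ψ = ψ ∘L φ)
    (hproj : ∀ φ ∈ F, φ ∘L φ = φ)
    (hpos : ∀ φ ∈ F, FiniteVN.IsNPositive m φ)
    (hbdd : ∃ C : ℝ, ∀ G ∈ FiniteVN.semigroupOf F, ‖G‖ ≤ C)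
    (hbdd' : ∃ C : ℝ, ∀ (G : FiniteVN.BM M) (hG : G ∈ FiniteVN.semigroupOf F)
      (X : FiniteVN.Elem M),
      ‖FiniteVN.tauDual τ G (FiniteVN.semigroupOf_subset_Bhat hF hG) X‖ ≤ C * ‖X‖) :
    ∃ E : FiniteVN.BM M, E ∈ FiniteVN.Bhat τ ∧ E ∘L E = E ∧ FiniteVN.IsNPositive m E ∧
      FiniteVN.WeaklyConverges F E := by
  obtain ⟨C, hC⟩ := hbdd
  obtain ⟨C', hC'⟩ := hbdd'
  rcases F.eq_empty_or_nonempty with rfl | hne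
  -- For empty `F` the net is empty and its filter is `⊥`, so the identity serves as a limit.
  · refine ⟨.id ℂ _, mem_Bhat_of_exists_adjoint τ fun Z => ⟨Z, fun X => rfl⟩, rfl,
      fun A hA => hA, fun l X => ?_⟩
    have : IsEmpty (semigroupOf (∅ : Set (BM M))) := ⟨fun G => by
      obtain ⟨G, hG⟩ := G
      cases hG <;> contradiction⟩
    rw [Filter.filter_eq_bot_of_isEmpty (semigroupTails _)]
    exact Filter.tendsto_bot
  have hlim : ∀ U : Ultrafilter (semigroupOf F), ∃ E : BM M, ∀ l ∈ predual M, ∀ X,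
      Filter.Tendsto (fun G : semigroupOf F => l ((G : BM M) X)) U (𝓝 (l (E X))) := fun U =>
    exists_pointwise_ultraweak_limit U fun G => hC G G.2
  choose E hE using hlim
  -- Z' is the ultraweak limit along U of the τ-duals applied to Z; their uniform bound is used
  -- here.
  have hadj : ∀ U Z, ∃ Z', ∀ X, τ.toFun (Z * E U X) = τ.toFun (Z' * X) := by
    intro U Z
    obtain ⟨Z', -, hZ'⟩ := exists_ultraweak_limit U fun G : semigroupOf F => hC' G G.2 Z
    refine ⟨Z', fun X => ?_⟩
    have h1 := hE U _ (trace_mul_left_mem_predual τ Z) X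
    have h2 := hZ' _ (trace_mul_right_mem_predual τ X)
    refine tendsto_nhds_unique h1 (h2.congr fun G => ?_)
    exact trace_tauDual _ Z X
  have hright : ∀ U : Ultrafilter (semigroupOf F), ↑U ≤ semigroupTails F →
      ∀ G ∈ semigroupOf F, ∀ X, E U (G X) = E U X := by
    intro U hU G hG X
    refine elem_ext_of_predual fun l hl => ?_
    refine tendsto_nhds_unique (hE U l hl (G X)) ((hE U l hl X).congr' ?_)
    filter_upwards [hU (eventually_semigroupLE hG)] with G' hG'
    obtain ⟨K, hK, h⟩ := hG'
    rw [h, ContinuousLinearMap.comp_apply, ContinuousLinearMap.comp_apply,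
      ← ContinuousLinearMap.comp_apply G G, semigroupOf_idempotent hcomm hproj hG]
  -- Ultraweak continuity of G lets it pass inside the limit, where G ∘ G' = G' eventually.
  have hleft : ∀ U : Ultrafilter (semigroupOf F), ↑U ≤ semigroupTails F →
      ∀ G ∈ semigroupOf F, ∀ X, G (E U X) = E U X := by
    intro U hU G hG X
    refine elem_ext_of_predual fun l hl => ?_
    have h1 := hE U _ (comp_mem_predual (semigroupOf_subset_Bhat hF hG).1 hl) X
    refine tendsto_nhds_unique h1 ((hE U l hl X).congr' ?_)
    filter_upwards [hU (eventually_semigroupLE hG)] with G' hG'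
    obtain ⟨K, hK, h⟩ := hG'
    have : G ∘L (G' : BM M) = G' := by
      rw [h, semigroupOf_comm hcomm hK hG, ← ContinuousLinearMap.comp_assoc,
        semigroupOf_idempotent hcomm hproj hG]
    exact congrArg l (DFunLike.congr_fun this X).symm
  have hfix : ∀ U V : Ultrafilter (semigroupOf F), ↑V ≤ semigroupTails F →
      ∀ X, E U (E V X) = E V X := by
    intro U V hV X
    refine elem_ext_of_predual fun l hl => ?_
    refine tendsto_nhds_unique (hE U l hl (E V X)) (tendsto_const_nhds.congr fun G => ?_)
    rw [hleft V hV G G.2]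
  -- Here `E U` must pass inside the limit along V: moving it onto Z by the adjoint leaves a normal
  -- functional of G X, and E U ∘ G = E U makes the net constant.
  have habs : ∀ U V : Ultrafilter (semigroupOf F), ↑U ≤ semigroupTails F →
      ∀ X, E U (E V X) = E U X := by
    intro U V hU X
    refine eq_of_trace_mul τ fun Z => ?_
    obtain ⟨Z', hZ'⟩ := hadj U Z
    rw [hZ']
    refine tendsto_nhds_unique (hE V _ (trace_mul_left_mem_predual τ Z') X)
      (tendsto_const_nhds.congr fun G => ?_)
    change _ = τ.toFun (Z' * (G : BM M) X)
    rw [← hZ', hright U hU G G.2]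
  have huniq : ∀ U V : Ultrafilter (semigroupOf F), ↑U ≤ semigroupTails F →
      ↑V ≤ semigroupTails F → E U = E V := fun U V hU hV =>
    ContinuousLinearMap.ext fun X => (habs U V hU X).symm.trans (hfix U V hV X)
  have hNeBot := semigroupTails_neBot hcomm hproj hne
  have hU := Ultrafilter.of_le (semigroupTails F)
  set U := Ultrafilter.of (semigroupTails F)
  refine ⟨E U, mem_Bhat_of_exists_adjoint τ (hadj U), ContinuousLinearMap.ext (hfix U U hU),
    isNPositive_of_tendsto (fun G : semigroupOf F => isNPositive_of_mem_semigroupOf hpos G.2)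
      (hE U), fun l X => ?_⟩
  rw [Filter.tendsto_iff_ultrafilter]
  intro V hV
  rw [huniq U V hU hV]
  exact hE V l l.2 X
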